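/- A negotiation diagram $\mathcal N$ consists of a finite set $\mathit{Proc}$ of processes, a finite set $N$ of nodes, a non-empty domain $\mathit{dom}(n)\subseteq \mathit{Proc}$ and a set $\mathit{out}(n)$ of outcomes for each node $n$, a partial transition function $\delta$ assigning to a node $n$, an outcome $a$ and a process $p$ a set $\delta(n,a,p)\subseteq N$, defined whenever $a\in \mathit{out}(n)$ and $p\in\mathit{dom}(n)$, such that $n'\in\delta(n,a,p)$ implies $p\in \mathit{dom}(n)\cap \mathit{dom}(n')$, and two nodes $n_{\mathit{init}}, n_{\mathit{fin}}$ with domain $\mathit{Proc}$; every node other than $n_{\mathit{fin}}$ has at least one outcome. A configuration is a map $C:\mathit{Proc}\to\mathcal P(N)$; it enables $n$ if $n\in C(p)$ for all $p\in \mathit{dom}(n)$. A location is a pair $\ell=(n,a)$ with $a\in \mathit{out}(n)$, and $\mathit{dom}(\ell)=\mathit{dom}(n)$; it is called a location of $n$. If $C$ enables $n$, executing $(n,a)$ leads from $C$ to the configuration $C'$ with $C'(p)=\delta(n,a,p)$ for $p\in \mathit{dom}(n)$ and $C'(p)=C(p)$ otherwise. A run is a sequence of such executions. Let $C_{\mathit{init}}(p)=\{n_{\mathit{init}}\}$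 and $C_{\mathit{fin}}(p)=\{n_{\mathit{fin}}\}$ for all $p$. A configuration is reachable if a finite run leads to it from $C_{\mathit{init}}$; a node is reachable if some reachable configuration enables it. $\mathcal N$ is sound if every finite run from $C_{\mathit{init}}$ can be extended to a run ending in $C_{\mathit{fin}}$, and deterministic if every $\delta(n,a,p)$ is empty or a singleton. An $m$-sequence is a finite sequence of locations whose domains are all included in $\mathit{dom}(m)$; it is strict if moreover the domains of all its locations, except possibly the first, are strictly included in $\mathit{dom}(m)$. **Theorem.** Let $m$ be a reachable node of a sound deterministic negotiation diagram $\mathcal N$. (i) There is a unique reachable configuration $I(m)$ that enables $m$ and no other node. (ii) There is a unique configuration $F(m)$ such that $F(m)$ is reachable from $I(m)$ by means of an $m$-sequence, and for every node $n\neq n_{\mathit{fin}}$ enabled at $F(m)$, $\mathit{dom}(n)$ is not included in $\mathit{dom}(m)$. (iii) For every location $\ell$ of $m$ there is a unique configuration $F(\ell)$ such that $F(\ell)$ is reachable from $I(m)$ by means of a strict $m$-sequence starting with $\ell$, and for every node $n$ enabled at $F(\ell)$, $\mathit{dom}(n)$ is not strictly included in $\mathit{dom}(m)$. -/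

import Mathlib

/-- A negotiation diagram with processes `Proc`, nodes `Node` and outcomes in `Res`.
The partial transition function is represented by a total set-valued function `delta`,
whose value is the empty set where the partial function is undefined. -/
structure NegotiationDiagram (Proc Node Res : Type*) where
  /-- the participants of a node -/
  dom : Node → Set Proc
  /-- the outcomes of a node -/
  out : Node → Set Res
  /-- `delta n a p` is the set of nodes in which `p` is ready to engage after outcome `a` of `n` -/
  delta : Node → Res → Proc → Set Node
  /-- the initial node -/
  nInit : Node
  /-- the final node -/
  nFin : Node
  dom_nonempty : ∀ n, (dom n).Nonempty
  delta_dom : ∀ n a p, ∀ n' ∈ delta n a p, p ∈ dom n' ∩ dom n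
  dom_nInit : dom nInit = Set.univ
  dom_nFin : dom nFin = Set.univ
  out_nonempty : ∀ n, n ≠ nFin → (out n).Nonempty

namespace NegotiationDiagram

variable {Proc Node Res : Type*} (N : NegotiationDiagram Proc Node Res)

/-- Node `n` is enabled in configuration `C`. -/
def Enabled (C : Proc → Set Node) (n : Node) : Prop :=
  ∀ p ∈ N.dom n, n ∈ C p

/-- `C --(n,a)--> C'`: the location `ℓ = (n, a)` can be executed in `C` and produces `C'`. -/
def Step (C : Proc → Set Node) (ℓ : Node × Res) (C' : Proc → Set Node) : Prop :=
  ℓ.2 ∈ N.out ℓ.1 ∧ N.Enabled C ℓ.1 ∧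
    (∀ p ∈ N.dom ℓ.1, C' p = N.delta ℓ.1 ℓ.2 p) ∧ (∀ p ∉ N.dom ℓ.1, C' p = C p)

/-- `C --w--> C'`: the finite sequence of locations `w` is a run from `C` to `C'`. -/
def Run (C : Proc → Set Node) : List (Node × Res) → (Proc → Set Node) → Prop
  | [], C' => C' = C
  | ℓ :: w, C' => ∃ C₁, N.Step C ℓ C₁ ∧ Run C₁ w C'

/-- The initial configuration. -/
def cInit : Proc → Set Node := fun _ => {N.nInit}

/-- The final configuration. -/
def cFin : Proc → Set Node := fun _ => {N.nFin}

/-- A configuration is reachable if it is reachable from the initial one by some finite run. -/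
def Reachable (C : Proc → Set Node) : Prop :=
  ∃ w, N.Run N.cInit w C

/-- A node is reachable if some reachable configuration enables it. -/
def ReachableNode (n : Node) : Prop :=
  ∃ C, N.Reachable C ∧ N.Enabled C n

/-- Every finite run from the initial configuration can be completed to a successful run. -/
def Sound : Prop :=
  ∀ w C, N.Run N.cInit w C → ∃ v, N.Run C v N.cFin

/-- Every set `delta n a p` is empty or a singleton. -/
def Deterministic : Prop :=
  ∀ n a p, (N.delta n a p).Subsingleton

/-- `w` is an `m`-sequence: all its domains are included in `dom m`. -/
def IsSeq (m : Node) (w : List (Node × Res)) : Prop :=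
  ∀ ℓ ∈ w, N.dom ℓ.1 ⊆ N.dom m

/-- `w` is a strict `m`-sequence: an `m`-sequence in which all domains, except possibly that
of the first location, are strictly included in `dom m`. -/
def IsStrictSeq (m : Node) (w : List (Node × Res)) : Prop :=
  N.IsSeq m w ∧ ∀ ℓ ∈ w.tail, N.dom ℓ.1 ⊂ N.dom m

/-- `I` is a reachable configuration that enables `m`, and no other node. -/
def IsFirst (m : Node) (I : Proc → Set Node) : Prop :=
  N.Reachable I ∧ N.Enabled I m ∧ ∀ n, N.Enabled I n → n = m

/-- `F` is reached from `I` by an `m`-sequence, and no node enabled at `F`, other than the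
final node of the diagram, has its domain included in `dom m`. -/
def IsLast (m : Node) (I F : Proc → Set Node) : Prop :=
  (∃ w, N.IsSeq m w ∧ N.Run I w F) ∧
    ∀ n, n ≠ N.nFin → N.Enabled F n → ¬ N.dom n ⊆ N.dom m

/-- `F` is reached from `I` by a strict `m`-sequence that starts with the location `(m, a)`, and
no node enabled at `F` has its domain strictly included in `dom m`. -/
def IsLastLoc (m : Node) (a : Res) (I F : Proc → Set Node) : Prop :=
  (∃ w, N.IsStrictSeq m ((m, a) :: w) ∧ N.Run I ((m, a) :: w) F) ∧
    ∀ n, N.Enabled F n → ¬ N.dom n ⊂ N.dom m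

end NegotiationDiagram

/-! Existence is commutation. By determinism a process is ready for at most one node, so distinct
enabled nodes have disjoint domains, and an enabled node executed later in a run can be executed
first. Soundness supplies a run to `cFin`, and `Run.drain` brings the nodes of the required kind to
its front.

Uniqueness rests on tokens. Select a process `s n` at each node and call `x` a token of `C` if `x ∈
C (s x)`. In a reachable configuration exactly one token has a path of selected moves to the final
node (`Run.exists_token`, `token_unique`). If `F` and `F'` differ, a suitable selection gives one of
them a token whose path to the final node carries no token of the other. When non-final nodes
enabled at the other are occupied at the first, the selection can be changed off this path so that
the other's tokens there are also tokens of the first, which then has two tokens with such paths: a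
contradiction. This is `eq_of_enabled`; it yields (i) and (ii). For (iii), nodes with domain equal
to `dom m` may be enabled at the end, so `Run.eq_of_ssubset` adds an induction that uses (ii) for
smaller domains. -/

/-- A walk ending at `t` either avoids `M` altogether, or has a last vertex in `M`. -/
theorem Relation.ReflTransGen.avoid_or_last {α : Type*} {r : α → α → Prop} (M : α → Prop)
    {z t : α} (h : Relation.ReflTransGen r z t) :
    (¬ M z ∧ Relation.ReflTransGen (fun a b => r a b ∧ ¬ M b) z t) ∨
      ∃ y, M y ∧ Relation.ReflTransGen (fun a b => r a b ∧ ¬ M b) y t := by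
  induction h using Relation.ReflTransGen.head_induction_on with
  | refl =>
    by_cases ht : M t
    · exact .inr ⟨t, ht, .refl⟩
    · exact .inl ⟨ht, .refl⟩
  | @head a c hac _ ih =>
    rcases ih with ⟨hc, hp⟩ | hy
    · by_cases ha : M a
      · exact .inr ⟨a, ha, .head ⟨hac, hc⟩ hp⟩
      · exact .inl ⟨ha, .head ⟨hac, hc⟩ hp⟩
    · exact .inr hy

namespace NegotiationDiagram

variable {Proc Node Res : Type*} {N : NegotiationDiagram Proc Node Res}
  {C C' F F' : Proc → Set Node} {m n x y : Node} {w u v : List (Node × Res)}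

/-! ### Runs and commutation of enabled nodes -/

theorem Run.append {C₁ C₂ C₃ : Proc → Set Node} (h₁ : N.Run C₁ u C₂) (h₂ : N.Run C₂ v C₃) :
    N.Run C₁ (u ++ v) C₃ := by
  induction u generalizing C₁ with
  | nil => cases h₁; exact h₂
  | cons ℓ u ih =>
    obtain ⟨K, hK, hr⟩ := h₁
    exact ⟨K, hK, ih hr⟩

theorem Reachable.run (h : N.Reachable C) (hr : N.Run C w C') : N.Reachable C' :=
  let ⟨u, hu⟩ := h
  ⟨u ++ w, hu.append hr⟩

theorem Reachable.step {ℓ : Node × Res} (h : N.Reachable C) (hs : N.Step C ℓ C') :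
    N.Reachable C' :=
  h.run (w := [ℓ]) ⟨C', hs, rfl⟩

/-- Configurations in which every process is ready for at most one node, which it belongs to. -/
def WellPlaced (N : NegotiationDiagram Proc Node Res) (C : Proc → Set Node) : Prop :=
  ∀ p, (C p).Subsingleton ∧ ∀ n ∈ C p, p ∈ N.dom n

theorem WellPlaced.run (hdet : N.Deterministic) (h : N.WellPlaced C) (hr : N.Run C w C') :
    N.WellPlaced C' := by
  induction w generalizing C with
  | nil => cases hr; exact h
  | cons ℓ w ih =>
    obtain ⟨K, ⟨-, -, hin, hout⟩, hr⟩ := hr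
    refine ih (fun p => ?_) hr
    by_cases hp : p ∈ N.dom ℓ.1
    · rw [hin p hp]
      exact ⟨hdet _ _ _, fun n hn => (N.delta_dom _ _ _ n hn).1⟩
    · rw [hout p hp]
      exact h p

theorem Reachable.wellPlaced (hdet : N.Deterministic) (h : N.Reachable C) : N.WellPlaced C := by
  obtain ⟨w, hw⟩ := h
  refine WellPlaced.run hdet (fun p => ⟨Set.subsingleton_singleton, ?_⟩) hw
  rintro n rfl
  simp [N.dom_nInit]

theorem WellPlaced.eq {p : Proc} (h : N.WellPlaced C) (hx : x ∈ C p) (hy : y ∈ C p) : x = y :=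
  (h p).1 hx hy

theorem Enabled.exists_step {a : Res} (he : N.Enabled C n) (ha : a ∈ N.out n) :
    ∃ K, N.Step C (n, a) K := by
  classical
  exact ⟨fun p => if p ∈ N.dom n then N.delta n a p else C p, ha, he,
    fun p hp => if_pos hp, fun p hp => if_neg hp⟩

theorem Sound.exists_run (h : N.Sound) (hC : N.Reachable C) : ∃ v, N.Run C v N.cFin :=
  let ⟨w, hw⟩ := hC
  h w C hw

theorem not_enabled_cFin (hn : n ≠ N.nFin) : ¬ N.Enabled N.cFin n := fun h =>
  let ⟨p, hp⟩ := N.dom_nonempty n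
  hn (h p hp)

/-- A node stays enabled while only other nodes are executed. -/
theorem Enabled.step (hC : N.WellPlaced C) {ℓ : Node × Res} (he : N.Enabled C n)
    (hs : N.Step C ℓ C') (hn : ℓ.1 ≠ n) : N.Enabled C' n := by
  intro p hp
  rw [hs.2.2.2 p fun hq => hn (hC.eq (hs.2.1 p hq) (he p hp))]
  exact he p hp

theorem Enabled.run (hdet : N.Deterministic) (hC : N.Reachable C) (he : N.Enabled C n)
    (hr : N.Run C w C') (hn : ∀ ℓ ∈ w, ℓ.1 ≠ n) : N.Enabled C' n := by
  induction w generalizing C with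
  | nil => cases hr; exact he
  | cons ℓ w ih =>
    obtain ⟨K, hs, hr⟩ := hr
    exact ih (hC.step hs) (he.step (hC.wellPlaced hdet) hs (hn ℓ (by simp))) hr
      fun k hk => hn k (by simp [hk])

theorem Run.eq_of_notMem {D : Set Proc} (hr : N.Run C w C') (hw : ∀ ℓ ∈ w, N.dom ℓ.1 ⊆ D)
    {p : Proc} (hp : p ∉ D) : C' p = C p := by
  induction w generalizing C with
  | nil => cases hr; rfl
  | cons ℓ w ih =>
    obtain ⟨K, hs, hr⟩ := hr
    rw [ih hr fun k hk => hw k (by simp [hk])]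
    exact hs.2.2.2 p fun h => hp (hw ℓ (by simp) h)

/-- An enabled node that is executed in a run can be executed first. -/
theorem Run.exists_step_of_enabled (hdet : N.Deterministic) (hC : N.Reachable C)
    (he : N.Enabled C n) (hr : N.Run C w C') (hn : ¬ N.Enabled C' n) :
    ∃ a K v, N.Step C (n, a) K ∧ N.Run K v C' ∧ v.length + 1 = w.length ∧
      (n, a) ∈ w ∧ v ⊆ w := by
  induction w generalizing C with
  | nil => cases hr; exact absurd he hn
  | cons ℓ w ih =>
    obtain ⟨K, hs, hr⟩ := hr
    by_cases hℓ : ℓ.1 = n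
    · subst hℓ
      exact ⟨ℓ.2, K, w, hs, hr, rfl, by simp, by simp⟩
    have hwp := hC.wellPlaced hdet
    have hdisj : ∀ p ∈ N.dom n, p ∉ N.dom ℓ.1 := fun p hp hq =>
      hℓ (hwp.eq (hs.2.1 p hq) (he p hp))
    obtain ⟨a, L, v, hsL, hrL, hlen, hmem, hsub⟩ :=
      ih (hC.step hs) (he.step hwp hs hℓ) hr
    obtain ⟨M, hM⟩ := he.exists_step hsL.1
    refine ⟨a, M, ℓ :: v, hM, ⟨L, ⟨hs.1, ?_, ?_, ?_⟩, hrL⟩, by simp [hlen], by simp [hmem],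
      List.cons_subset_cons _ hsub⟩
    · exact hs.2.1.step hwp hM (Ne.symm hℓ)
    · intro p hp
      rw [hsL.2.2.2 p fun h => hdisj p h hp, hs.2.2.1 p hp]
    · intro p hp
      by_cases hq : p ∈ N.dom n
      · rw [hsL.2.2.1 p hq, hM.2.2.1 p hq]
      · rw [hsL.2.2.2 p hq, hM.2.2.2 p hq, hs.2.2.2 p hp]

/-- If no node of `Q` is enabled at the end of a run, the run can be rearranged so that
it starts by executing nodes of `Q` until none of them is enabled. -/
theorem Run.drain (hdet : N.Deterministic) (Q : Node → Prop) (hC : N.Reachable C)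
    (hr : N.Run C w F) (hF : ∀ n, Q n → ¬ N.Enabled F n) :
    ∃ u K v, N.Run C u K ∧ N.Run K v F ∧ (∀ ℓ ∈ u, Q ℓ.1) ∧ (∀ n, Q n → ¬ N.Enabled K n) ∧
      u.length + v.length = w.length ∧ u ⊆ w ∧ v ⊆ w := by
  induction hk : w.length generalizing C w with
  | zero =>
    obtain rfl := List.length_eq_zero_iff.1 hk
    cases hr
    exact ⟨[], _, [], rfl, rfl, by simp, hF, by simp, by simp, by simp⟩
  | succ k ih =>
    by_cases hex : ∃ n, Q n ∧ N.Enabled C n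
    · obtain ⟨n, hQ, he⟩ := hex
      obtain ⟨a, L, w', hs, hr', hlen, hmem, hsub⟩ :=
        hr.exists_step_of_enabled hdet hC he (hF n hQ)
      obtain ⟨u, K, v, hu, hv, huQ, hK, hl, hus, hvs⟩ := ih (hC.step hs) hr' (by omega)
      refine ⟨(n, a) :: u, K, v, ⟨L, hs, hu⟩, hv, ?_, hK, by simp; omega, ?_, List.Subset.trans hvs hsub⟩
      · rintro ℓ (_ | ⟨_, hℓ⟩)
        exacts [hQ, huQ ℓ hℓ]
      · exact List.cons_subset.2 ⟨hmem, List.Subset.trans hus hsub⟩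
    · push Not at hex
      exact ⟨[], C, w, rfl, hr, by simp, hex, by simp [hk], by simp, by simp⟩

/-! ### Tokens of a selection of processes -/

/-- Process `s n'` can move directly from `n` to `n'`. -/
def SelEdge (N : NegotiationDiagram Proc Node Res) (s : Node → Proc) (n n' : Node) : Prop :=
  ∃ a ∈ N.out n, n' ∈ N.delta n a (s n')

/-- If a process `s n` is selected at every node `n`, then some selected process
is at its node, and this node is joined to the final node by moves of selected processes. -/
theorem Run.exists_token {s : Node → Proc} (hs : ∀ n, s n ∈ N.dom n) (hr : N.Run C w N.cFin) :
    ∃ x, x ∈ C (s x) ∧ Relation.ReflTransGen (N.SelEdge s) x N.nFin := by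
  induction w generalizing C with
  | nil =>
    rw [← show N.cFin = C from hr]
    exact ⟨N.nFin, rfl, .refl⟩
  | cons ℓ w ih =>
    obtain ⟨K, hst, hr⟩ := hr
    obtain ⟨x, hx, hp⟩ := ih hr
    by_cases h : s x ∈ N.dom ℓ.1
    · rw [hst.2.2.1 _ h] at hx
      -- All processes of the executed node are at it, in particular its selected one, so it is a
      -- token one move before `x`.
      exact ⟨ℓ.1, hst.2.1 _ (hs _), .head ⟨ℓ.2, hst.1, hx⟩ hp⟩
    · rw [hst.2.2.2 _ h] at hx
      exact ⟨x, hx, hp⟩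

/-- Until `x` or `y` is executed, both tokens stay in place; but at `cFin` both would be the final
node. -/
theorem exists_enabled_of_two_tokens (hdet : N.Deterministic) {s : Node → Proc} (hxy : x ≠ y)
    (hC : N.Reachable C) (hx : x ∈ C (s x)) (hy : y ∈ C (s y)) (hr : N.Run C w N.cFin) :
    ∃ K, N.Reachable K ∧ x ∈ K (s x) ∧ y ∈ K (s y) ∧ (N.Enabled K x ∨ N.Enabled K y) := by
  induction w generalizing C with
  | nil =>
    rw [← show N.cFin = C from hr] at hx hy
    exact absurd (hx.trans hy.symm) hxy
  | cons ℓ w ih =>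
    obtain ⟨K, hst, hr⟩ := hr
    have hwp := hC.wellPlaced hdet
    by_cases h₁ : ℓ.1 = x
    · exact ⟨C, hC, hx, hy, .inl (h₁ ▸ hst.2.1)⟩
    by_cases h₂ : ℓ.1 = y
    · exact ⟨C, hC, hx, hy, .inr (h₂ ▸ hst.2.1)⟩
    refine ih (hC.step hst) ?_ ?_ hr
    · rwa [hst.2.2.2 _ fun h => h₁ (hwp.eq (hst.2.1 _ h) hx)]
    · rwa [hst.2.2.2 _ fun h => h₂ (hwp.eq (hst.2.1 _ h) hy)]

/-- There is a path of `k` moves of selected processes from a node to the final node. -/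
def SelPath (N : NegotiationDiagram Proc Node Res) (s : Node → Proc) : ℕ → Node → Prop
  | 0, n => n = N.nFin
  | k + 1, n => ∃ n', N.SelEdge s n n' ∧ SelPath N s k n'

theorem exists_selPath {s : Node → Proc} (h : Relation.ReflTransGen (N.SelEdge s) x N.nFin) :
    ∃ k, N.SelPath s k x := by
  induction h using Relation.ReflTransGen.head_induction_on with
  | refl => exact ⟨0, rfl⟩
  | head hac _ ih =>
    obtain ⟨k, hk⟩ := ih
    exact ⟨k + 1, _, hac, hk⟩

/-- Induction on the total length of the two paths: wait until one of the two nodes is enabled, then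
move that token one step along its path; the other does not move. -/
theorem SelPath.not_two_tokens (hdet : N.Deterministic) (hsound : N.Sound) {s : Node → Proc}
    {i j : ℕ} (hi : N.SelPath s i x) (hj : N.SelPath s j y) (hC : N.Reachable C)
    (hx : x ∈ C (s x)) (hy : y ∈ C (s y)) (hxy : x ≠ y) : False := by
  induction hk : i + j using Nat.strong_induction_on generalizing i j x y C with
  | _ k ih =>
    subst hk
    obtain ⟨w, hw⟩ := hsound.exists_run hC
    obtain ⟨K, hK, hxK, hyK, he⟩ := exists_enabled_of_two_tokens hdet hxy hC hx hy hw
    have hwp := hK.wellPlaced hdet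
    wlog hex : N.Enabled K x generalizing x y i j
    · exact this hj hi hy hx hxy.symm (by rwa [Nat.add_comm]) hyK hxK he.symm
        (he.resolve_left hex)
    have hyx : s y ∉ N.dom x := fun h => hxy (hwp.eq (hex _ h) hyK)
    cases i with
    | zero =>
      -- The final node, being enabled, would hold every process, including that of the other token.
      obtain rfl : x = N.nFin := hi
      simp [N.dom_nFin] at hyx
    | succ i =>
      obtain ⟨z, ⟨a, ha, hz⟩, hzi⟩ := hi
      obtain ⟨L, hL⟩ := hex.exists_step ha
      have hzx := (N.delta_dom _ _ _ _ hz).2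
      refine ih (i + j) (by omega) hzi hj (hK.step hL) ?_ ?_ ?_ rfl
      · rwa [hL.2.2.1 _ hzx]
      · rwa [hL.2.2.2 _ hyx]
      · rintro rfl
        exact hyx hzx

/-- Two selected processes cannot both be at their nodes, if these nodes are joined to the
final node by moves of selected processes. -/
theorem token_unique (hdet : N.Deterministic) (hsound : N.Sound) {s : Node → Proc}
    (hC : N.Reachable C) (hx : x ∈ C (s x)) (hy : y ∈ C (s y))
    (hpx : Relation.ReflTransGen (N.SelEdge s) x N.nFin)
    (hpy : Relation.ReflTransGen (N.SelEdge s) y N.nFin) : x = y := by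
  by_contra hxy
  obtain ⟨i, hi⟩ := exists_selPath hpx
  obtain ⟨j, hj⟩ := exists_selPath hpy
  exact hi.not_two_tokens hdet hsound hj hC hx hy hxy

theorem Run.nonempty {p : Proc} (hr : N.Run C w N.cFin) : (C p).Nonempty := by
  induction w generalizing C with
  | nil =>
    rw [← show N.cFin = C from hr]
    exact ⟨N.nFin, rfl⟩
  | cons ℓ w ih =>
    obtain ⟨K, hst, hr⟩ := hr
    by_cases h : p ∈ N.dom ℓ.1
    · exact ⟨_, hst.2.1 p h⟩
    · rw [← hst.2.2.2 p h]
      exact ih hr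

/-! ### Paths to the final node and selections following them -/

/-- Some process can move directly from `n` to `n'`. -/
def Edge (N : NegotiationDiagram Proc Node Res) (n n' : Node) : Prop :=
  ∃ a ∈ N.out n, ∃ p, n' ∈ N.delta n a p

theorem Run.reflTransGen_edge (hdet : N.Deterministic) {p : Proc} (hC : N.Reachable C)
    (hx : x ∈ C p) (hr : N.Run C w N.cFin) : Relation.ReflTransGen N.Edge x N.nFin := by
  induction w generalizing C x with
  | nil =>
    rw [← show N.cFin = C from hr] at hx
    rw [show x = N.nFin from hx]
  | cons ℓ w ih =>
    obtain ⟨K, hst, hr⟩ := hr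
    by_cases h : p ∈ N.dom ℓ.1
    · obtain ⟨z, hz⟩ := hr.nonempty (p := p)
      have hpath := ih (hC.step hst) hz hr
      rw [hst.2.2.1 p h] at hz
      obtain rfl := (hC.wellPlaced hdet).eq (hst.2.1 p h) hx
      exact .head ⟨ℓ.2, hst.1, p, hz⟩ hpath
    · exact ih (hC.step hst) (by rwa [hst.2.2.2 p h]) hr

/-- A path can be followed by selecting one process at every node, with a prescribed
process at the first node. -/
theorem exists_selection {t : Node} (h : Relation.ReflTransGen N.Edge x t) {p : Proc}
    (hp : p ∈ N.dom x) :
    ∃ s : Node → Proc, s x = p ∧ (∀ n, s n ∈ N.dom n) ∧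
      Relation.ReflTransGen (N.SelEdge s) x t := by
  classical
  induction h using Relation.ReflTransGen.head_induction_on generalizing p with
  | refl =>
    refine ⟨Function.update (fun n => (N.dom_nonempty n).some) t p, by simp, fun n => ?_, .refl⟩
    by_cases hn : n = t
    · subst hn; simpa using hp
    · simpa [hn] using (N.dom_nonempty n).some_mem
  | @head x z hxz _ ih =>
    obtain ⟨a, ha, q, hq⟩ := hxz
    obtain ⟨s, hsz, hs, hpath⟩ := ih (N.delta_dom _ _ _ _ hq).1
    have hmono : ∀ b c, N.SelEdge s b c ∧ ¬ c = x → N.SelEdge (Function.update s x p) b c := by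
      rintro b c ⟨⟨a', ha', hc⟩, hcx⟩
      exact ⟨a', ha', by rwa [Function.update_of_ne hcx]⟩
    refine ⟨Function.update s x p, by simp, fun n => ?_, ?_⟩
    · by_cases hn : n = x
      · subst hn; simpa using hp
      · simpa [hn] using hs n
    -- Resetting `s x` spoils only moves into `x`, so if the path returns to `x` it is cut at its
    -- last visit there.
    · rcases hpath.avoid_or_last (· = x) with ⟨hzx, hpath⟩ | ⟨y, rfl, hpath⟩
      · exact .head ⟨a, ha, by rwa [Function.update_of_ne hzx, hsz]⟩ (.mono hmono _ _ hpath)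
      · exact .mono hmono _ _ hpath

/-! ### Comparing two reachable configurations -/

/-- Suppose that every node enabled at `F` is occupied at `F'` by one of its processes. Then no
token of `F'` has a path to the final node that is free of tokens of `F`. -/
theorem false_of_unmarked_path (hdet : N.Deterministic) (hsound : N.Sound) {s : Node → Proc}
    (hs : ∀ n, s n ∈ N.dom n) (P : Set Node) (hF : N.Reachable F) (hF' : N.Reachable F')
    (henab : ∀ n, n ≠ N.nFin → N.Enabled F n → ∃ q ∈ N.dom n, n ∈ F' q)
    (hxP : x ∈ P) (hx : x ∈ F' (s x)) (hP : ∀ n ∈ P, n ∉ F (s n))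
    (hpath : Relation.ReflTransGen (fun a b => N.SelEdge s a b ∧ b ∈ P) x N.nFin) : False := by
  classical
  have hfin : N.nFin ∈ P := by
    rcases hpath.cases_tail with h | ⟨_, _, _, h⟩
    · rwa [h]
    · exact h
  -- Keep the selection on `P`. Elsewhere, select a process not at `n` in `F` if there is one;
  -- otherwise `n` is enabled at `F`, and a process at `n` in `F'` is available. Every token of `F`
  -- off `P` is then one of `F'`.
  have hq : ∀ n, ∃ q ∈ N.dom n, (n ∈ P → q = s n) ∧
      (n ∉ P → n ∈ F q → n ∈ F' q) := by
    intro n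
    by_cases hn : n ∈ P
    · exact ⟨s n, hs n, fun _ => rfl, fun h => absurd hn h⟩
    by_cases he : N.Enabled F n
    · obtain ⟨q, hq, hnq⟩ := henab n (fun h => hn (h ▸ hfin)) he
      exact ⟨q, hq, fun h => absurd h hn, fun _ _ => hnq⟩
    · simp only [Enabled, not_forall] at he
      obtain ⟨q, hq, hnq⟩ := he
      exact ⟨q, hq, fun h => absurd h hn, fun _ h => absurd h hnq⟩
  choose s' hs' heq hmark using hq
  obtain ⟨w, hw⟩ := hsound.exists_run hF
  obtain ⟨y, hy, hpy⟩ := hw.exists_token hs'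
  have hyP : y ∉ P := fun h => hP y h (heq y h ▸ hy)
  have hpx : Relation.ReflTransGen (N.SelEdge s') x N.nFin := by
    refine Relation.ReflTransGen.mono ?_ _ _ hpath
    rintro b c ⟨⟨a, ha, hc⟩, hcP⟩
    exact ⟨a, ha, by rwa [heq c hcP]⟩
  obtain rfl := token_unique hdet hsound hF' (hmark y hyP hy) (by rwa [heq x hxP]) hpy hpx
  exact hyP hxP

theorem subset_of_enabled (hdet : N.Deterministic) (hsound : N.Sound)
    (hF : N.Reachable F) (hF' : N.Reachable F')
    (h : ∀ n, n ≠ N.nFin → N.Enabled F n → ∃ q ∈ N.dom n, n ∈ F' q)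
    (h' : ∀ n, n ≠ N.nFin → N.Enabled F' n → ∃ q ∈ N.dom n, n ∈ F q) (p : Proc) :
    F' p ⊆ F p := by
  intro x hx
  by_contra hxF
  obtain ⟨w, hw⟩ := hsound.exists_run hF'
  obtain ⟨s, rfl, hs, hpath⟩ := exists_selection (hw.reflTransGen_edge hdet hF' hx)
    (((hF'.wellPlaced hdet) p).2 x hx)
  -- After the last node of the path that is a token of either configuration, the path carries no
  -- tokens.
  let M : Node → Prop := fun n => n ∈ F (s n) ∨ n ∈ F' (s n)
  obtain ⟨hM, -⟩ | ⟨y, hM, hpy⟩ := hpath.avoid_or_last M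
  · exact hM (.inr hx)
  have hpy' : Relation.ReflTransGen (fun a b => N.SelEdge s a b ∧ b ∈ {n | n = y ∨ ¬ M n}) y
      N.nFin := .mono (fun b c hbc => ⟨hbc.1, .inr hbc.2⟩) _ _ hpy
  by_cases hy : y ∈ F' (s y)
  -- Both are tokens of `F'` with paths to the end, so the last marked node is `x` itself, which is
  -- not a token of `F`. In the other case the roles of `F` and `F'` are exchanged.
  · obtain rfl := token_unique hdet hsound hF' hx hy hpath (.mono (fun _ _ h => h.1) _ _ hpy)
    refine false_of_unmarked_path hdet hsound hs _ hF hF' h (.inl rfl) hx ?_ hpy'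
    rintro n (rfl | hn)
    exacts [hxF, fun h => hn (.inl h)]
  · refine false_of_unmarked_path hdet hsound hs _ hF' hF h' (.inl rfl) (hM.resolve_right hy) ?_
      hpy'
    rintro n (rfl | hn)
    exacts [hy, fun h => hn (.inr h)]

/-- Two reachable configurations of a sound deterministic negotiation diagram are equal if every
node enabled at one of them is occupied at the other by one of its processes. -/
theorem eq_of_enabled (hdet : N.Deterministic) (hsound : N.Sound)
    (hF : N.Reachable F) (hF' : N.Reachable F')
    (h : ∀ n, n ≠ N.nFin → N.Enabled F n → ∃ q ∈ N.dom n, n ∈ F' q)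
    (h' : ∀ n, n ≠ N.nFin → N.Enabled F' n → ∃ q ∈ N.dom n, n ∈ F q) : F = F' :=
  funext fun p => (subset_of_enabled hdet hsound hF' hF h' h p).antisymm
    (subset_of_enabled hdet hsound hF hF' h h' p)

/-- Two reachable configurations that agree outside `D` are equal if every node enabled at one of
them has a process outside `D` or is occupied at both by one of its processes. -/
theorem eq_of_eqOn_compl (hdet : N.Deterministic) (hsound : N.Sound) {D : Set Proc}
    (hF : N.Reachable F) (hF' : N.Reachable F') (heq : ∀ p ∉ D, F p = F' p)
    (h : ∀ n, n ≠ N.nFin → N.Enabled F n → N.dom n ⊆ D → ∃ q ∈ N.dom n, n ∈ F' q)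
    (h' : ∀ n, n ≠ N.nFin → N.Enabled F' n → N.dom n ⊆ D → ∃ q ∈ N.dom n, n ∈ F q) :
    F = F' := by
  refine eq_of_enabled hdet hsound hF hF' (fun n hn he => ?_) fun n hn he => ?_
  · by_cases hD : N.dom n ⊆ D
    · exact h n hn he hD
    · obtain ⟨q, hq, hqD⟩ := Set.not_subset.1 hD
      exact ⟨q, hq, heq q hqD ▸ he q hq⟩
  · by_cases hD : N.dom n ⊆ D
    · exact h' n hn he hD
    · obtain ⟨q, hq, hqD⟩ := Set.not_subset.1 hD
      exact ⟨q, hq, heq q hqD ▸ he q hq⟩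

/-! ### Existence and uniqueness of `I(m)`, `F(m)` and `F(ℓ)` -/

theorem exists_isFirst (hdet : N.Deterministic) (hsound : N.Sound) (hm : N.ReachableNode m) :
    ∃ I, N.IsFirst m I := by
  obtain ⟨C, hC, he⟩ := hm
  obtain ⟨w, hw⟩ := hsound.exists_run hC
  obtain ⟨u, K, v, hu, -, huQ, hK, -⟩ := hw.drain hdet (fun n => n ≠ m ∧ n ≠ N.nFin) hC
    fun n hn => not_enabled_cFin hn.2
  have hmK := he.run hdet hC hu fun ℓ hℓ => (huQ ℓ hℓ).1
  refine ⟨K, hC.run hu, hmK, fun n hn => ?_⟩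
  by_contra hnm
  -- The final node could not be drained, since it is enabled at `cFin`; but if enabled it would
  -- hold the processes of `m` too.
  by_cases hf : n = N.nFin
  · subst hf
    obtain ⟨p, hp⟩ := N.dom_nonempty m
    exact hnm (((hC.run hu).wellPlaced hdet).eq (hn p (by simp [N.dom_nFin])) (hmK p hp))
  · exact hK n ⟨hnm, hf⟩ hn

theorem IsFirst.unique (hdet : N.Deterministic) (hsound : N.Sound) (h : N.IsFirst m F)
    (h' : N.IsFirst m F') : F = F' := by
  obtain ⟨p, hp⟩ := N.dom_nonempty m
  refine eq_of_enabled hdet hsound h.1 h'.1 (fun n _ hn => ?_) fun n _ hn => ?_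
  · obtain rfl := h.2.2 n hn
    exact ⟨p, hp, h'.2.1 p hp⟩
  · obtain rfl := h'.2.2 n hn
    exact ⟨p, hp, h.2.1 p hp⟩

theorem exists_isLast (hdet : N.Deterministic) (hsound : N.Sound) (hC : N.Reachable C) :
    ∃ F, N.IsLast m C F := by
  obtain ⟨w, hw⟩ := hsound.exists_run hC
  obtain ⟨u, K, v, hu, -, huQ, hK, -⟩ := hw.drain hdet
    (fun n => n ≠ N.nFin ∧ N.dom n ⊆ N.dom m) hC fun n hn => not_enabled_cFin hn.1
  exact ⟨K, ⟨u, fun ℓ hℓ => (huQ ℓ hℓ).2, hu⟩, fun n hn he hD => hK n ⟨hn, hD⟩ he⟩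

theorem IsLast.unique (hdet : N.Deterministic) (hsound : N.Sound) (hC : N.Reachable C)
    (h : N.IsLast m C F) (h' : N.IsLast m C F') : F = F' := by
  obtain ⟨⟨w, hw, hr⟩, hF⟩ := h
  obtain ⟨⟨w', hw', hr'⟩, hF'⟩ := h'
  refine eq_of_eqOn_compl (D := N.dom m) hdet hsound (hC.run hr) (hC.run hr') (fun p hp => ?_)
    (fun n hn he hD => absurd hD (hF n hn he)) fun n hn he hD => absurd hD (hF' n hn he)
  rw [hr.eq_of_notMem hw hp, hr'.eq_of_notMem hw' hp]

theorem ne_nFin_of_ssubset {D : Set Proc} (h : N.dom n ⊂ D) : n ≠ N.nFin := by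
  rintro rfl
  exact h.2 (by simp [N.dom_nFin])

theorem exists_isLastLoc (hdet : N.Deterministic) (hsound : N.Sound) (hC : N.Reachable C)
    (he : N.Enabled C m) {a : Res} (ha : a ∈ N.out m) : ∃ F, N.IsLastLoc m a C F := by
  obtain ⟨L, hL⟩ := he.exists_step ha
  have hLr := hC.step hL
  obtain ⟨w, hw⟩ := hsound.exists_run hLr
  obtain ⟨u, K, v, hu, -, huQ, hK, -⟩ := hw.drain hdet (fun n => N.dom n ⊂ N.dom m) hLr
    fun n hn => not_enabled_cFin (ne_nFin_of_ssubset hn)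
  refine ⟨K, ⟨u, ⟨?_, huQ⟩, L, hL, hu⟩, fun n he hD => hK n hD he⟩
  rintro ℓ (_ | ⟨_, hℓ⟩)
  exacts [subset_rfl, (huQ ℓ hℓ).1]

/-- Executing nodes with domain strictly included in `D` until none is enabled leads to
a unique configuration. -/
theorem Run.eq_of_ssubset (hdet : N.Deterministic) (hsound : N.Sound) {D : Set Proc}
    (hC : N.Reachable C) (hr : N.Run C w F) (hr' : N.Run C u F')
    (hw : ∀ ℓ ∈ w, N.dom ℓ.1 ⊂ D) (hu : ∀ ℓ ∈ u, N.dom ℓ.1 ⊂ D)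
    (hF : ∀ n, N.dom n ⊂ D → ¬ N.Enabled F n) (hF' : ∀ n, N.dom n ⊂ D → ¬ N.Enabled F' n) :
    F = F' := by
  induction hk : w.length using Nat.strong_induction_on generalizing w u C with
  | _ k ih =>
    subst hk
    by_cases hex : ∃ x, N.dom x ⊂ D ∧ N.Enabled C x
    swap
    · have hnil : ∀ {v G}, N.Run C v G → (∀ ℓ ∈ v, N.dom ℓ.1 ⊂ D) → G = C := by
        rintro (_ | ⟨ℓ, v⟩) G hv hvD
        · exact hv
        · obtain ⟨K, hst, -⟩ := hv
          exact absurd ⟨ℓ.1, hvD ℓ (by simp), hst.2.1⟩ hex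
      rw [hnil hr hw, hnil hr' hu]
    obtain ⟨x, hxD, hx⟩ := hex
    -- Postponing `x` in both runs makes it a common blocker: a node with domain exactly `D` shares
    -- processes with `x`, so it cannot be enabled together with `x`.
    obtain ⟨a, K, b, ha, hb, haQ, hK, hlen, haw, hbw⟩ :=
      hr.drain hdet (fun n => N.dom n ⊂ D ∧ n ≠ x) hC fun n hn => hF n hn.1
    obtain ⟨a', K', b', ha', hb', haQ', hK', -, -, hbu⟩ :=
      hr'.drain hdet (fun n => N.dom n ⊂ D ∧ n ≠ x) hC fun n hn => hF' n hn.1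
    have hxK := hx.run hdet hC ha fun ℓ hℓ => (haQ ℓ hℓ).2
    have hxK' := hx.run hdet hC ha' fun ℓ hℓ => (haQ' ℓ hℓ).2
    have hKr := hC.run ha
    obtain ⟨p, hp⟩ := N.dom_nonempty x
    have key : ∀ {G : Proc → Set Node}, N.Reachable G → N.Enabled G x →
        (∀ n, N.dom n ⊂ D ∧ n ≠ x → ¬ N.Enabled G n) → ∀ n, N.Enabled G n → N.dom n ⊆ D →
        n = x := by
      intro G hG hxG hQ n hn hnD
      by_contra hnx
      refine hQ n ⟨⟨hnD, fun h => hnx ?_⟩, hnx⟩ hn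
      exact (hG.wellPlaced hdet).eq (hn p (h (hxD.1 hp))) (hxG p hp)
    obtain rfl : K = K' := by
      refine eq_of_eqOn_compl (D := D) hdet hsound hKr (hC.run ha') (fun q hq => ?_)
        (fun n _ hn hnD => ?_) fun n _ hn hnD => ?_
      · rw [ha.eq_of_notMem (fun ℓ hℓ => (haQ ℓ hℓ).1.1) hq,
          ha'.eq_of_notMem (fun ℓ hℓ => (haQ' ℓ hℓ).1.1) hq]
      · obtain rfl := key hKr hxK hK n hn hnD
        exact ⟨p, hp, hxK' p hp⟩
      · obtain rfl := key (hC.run ha') hxK' hK' n hn hnD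
        exact ⟨p, hp, hxK p hp⟩
    -- From the common configuration `K`, both runs can first exhaust the nodes with domain inside
    -- `dom x`; the uniqueness in (ii), for `x`, makes them meet again.
    obtain ⟨c, G, d, hc, hd, hcQ, hG, hlen', -, hdb⟩ :=
      hb.drain hdet (fun n => N.dom n ⊆ N.dom x) hKr fun n hn => hF n (hn.trans_ssubset hxD)
    obtain ⟨c', G', d', hc', hd', hcQ', hG', -, -, hdb'⟩ :=
      hb'.drain hdet (fun n => N.dom n ⊆ N.dom x) hKr fun n hn => hF' n (hn.trans_ssubset hxD)
    obtain rfl : G = G' :=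
      IsLast.unique (m := x) hdet hsound hKr ⟨⟨c, hcQ, hc⟩, fun n _ he hn => hG n hn he⟩
        ⟨⟨c', hcQ', hc'⟩, fun n _ he hn => hG' n hn he⟩
    -- At least `x` is executed between `K` and `G`, so the rest of the run is strictly shorter.
    have hcpos : 0 < c.length := by
      rcases c with _ | ⟨ℓ, c⟩
      · obtain rfl : G = K := hc
        exact absurd hxK (hG x subset_rfl)
      · simp
    exact ih d.length (by omega) (hKr.run hc) hd hd' (fun ℓ hℓ => hw ℓ (hbw (hdb hℓ)))
      (fun ℓ hℓ => hu ℓ (hbu (hdb' hℓ))) rfl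

theorem IsLastLoc.unique (hdet : N.Deterministic) (hsound : N.Sound) (hC : N.Reachable C)
    {a : Res} (h : N.IsLastLoc m a C F) (h' : N.IsLastLoc m a C F') : F = F' := by
  obtain ⟨⟨w, ⟨-, hw⟩, K, hs, hr⟩, hF⟩ := h
  obtain ⟨⟨w', ⟨-, hw'⟩, K', hs', hr'⟩, hF'⟩ := h'
  obtain rfl : K = K' := by
    funext p
    by_cases hp : p ∈ N.dom m
    · rw [hs.2.2.1 p hp, hs'.2.2.1 p hp]
    · rw [hs.2.2.2 p hp, hs'.2.2.2 p hp]
  exact hr.eq_of_ssubset hdet hsound (hC.step hs) hr' hw hw' (fun n hn he => hF n he hn)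
    fun n hn he => hF' n he hn

end NegotiationDiagram

theorem mainTheorem2 {Proc Node Res : Type*} [Finite Proc] [Finite Node]
    (N : NegotiationDiagram Proc Node Res) (hsound : N.Sound) (hdet : N.Deterministic)
    (m : Node) (hm : N.ReachableNode m) :
    (∃! I, N.IsFirst m I) ∧
      ∀ I, N.IsFirst m I →
        (∃! F, N.IsLast m I F) ∧ ∀ a ∈ N.out m, ∃! F, N.IsLastLoc m a I F := by
  refine ⟨existsUnique_of_exists_of_unique (NegotiationDiagram.exists_isFirst hdet hsound hm)
    fun _ _ h h' => h.unique hdet hsound h', fun I hI => ⟨?_, fun a ha => ?_⟩⟩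
  · exact existsUnique_of_exists_of_unique (NegotiationDiagram.exists_isLast hdet hsound hI.1)
      fun _ _ h h' => h.unique hdet hsound hI.1 h'
  · exact existsUnique_of_exists_of_unique
      (NegotiationDiagram.exists_isLastLoc hdet hsound hI.1 hI.2.1 ha)
      fun _ _ h h' => h.unique hdet hsound hI.1 h'
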